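/- All graphs are non-empty, finite, simple and undirected. For a graph $G$ and an integer $r \ge 0$, a graph $H$ is an $r$-shallow topological minor of $G$ if there are an injective map $\phi_V \colon V(H) \to V(G)$ and, for every edge $uv$ of $H$, a path $\phi_E(uv)$ in $G$ of length at most $2r+1$ with endpoints $\phi_V(u)$ and $\phi_V(v)$, such that the paths assigned to distinct edges are internally vertex-disjoint (no inner vertex of one lies on the other). Let \[ \widetilde\nabla_r(G) := \max_{H} \frac{|E(H)|}{|V(H)|}, \] where the maximum is over all $r$-shallow topological minors $H$ of $G$, and let \[ \nu_r(G) := \max_{H \subseteq G,\ \emptyset \ne X \subseteq V(H)} \frac{\bigl|\{\, N^r_H[v] \cap X : v \in V(H) \,\}\bigr|}{|X|}, \] where the maximum is over all subgraphs $H$ of $G$ and all nonempty $X \subseteq V(H)$, and $N^r_H[v]$ is the set of vertices at distance at most $r$ from $v$ in $H$. A graph class $\mathcal G$ has bounded expansion if there is a function $f \colon \mathbb N \to \mathbb R$ such that $\sup_{G \in \mathcal G} \widetilde\nabla_r(G) \le f(r)$ for all integers $r \ge 0$, and it has bounded neighbourhood complexity if there is a function $f \colon \mathbb N \to \mathbb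 R$ such that $\sup_{G \in \mathcal G} \nu_r(G) \le f(r)$ for all integers $r \ge 0$ (with the supremum over the empty class taken to be $0$). **Theorem.** A graph class $\mathcal G$ has bounded expansion if and only if it has bounded neighbourhood complexity. -/

import Mathlib

open scoped ENNReal NNReal

universe u

/-- A nonempty finite simple undirected graph, bundled with its vertex set. -/
structure FinGraph : Type (u + 1) where
  /-- the vertex set -/
  V : Type u
  /-- there is at least one vertex -/
  nonempty : Nonempty V
  /-- the vertex set is finite -/
  finite : Finite V
  /-- the adjacency structure -/
  graph : SimpleGraph V

namespace FinGraph

/-- A topological minor embedding of `H` into `G`: an injection of vertices together with a path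
of `G` for every edge `uv` of `H`, joining the images of `u` and `v`. The path assigned to an edge
does not depend on the direction in which the edge is read. Paths of distinct edges are internally
vertex-disjoint: a vertex lying on both of them is an end of both of them, so an inner vertex of
one is not on the other, not even as an end. -/
structure TopMinorEmbedding (H G : FinGraph.{u}) where
  /-- the vertex map -/
  vert : H.V → G.V
  vert_injective : Function.Injective vert
  /-- the edge map -/
  path : ∀ {a b : H.V}, H.graph.Adj a b → G.graph.Walk (vert a) (vert b)
  isPath : ∀ {a b : H.V} (h : H.graph.Adj a b), (path h).IsPath
  path_symm : ∀ {a b : H.V} (h : H.graph.Adj a b), path h.symm = (path h).reverse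
  internally_disjoint : ∀ {a b c d : H.V} (h : H.graph.Adj a b) (h' : H.graph.Adj c d),
    s(a, b) ≠ s(c, d) → ∀ x ∈ (path h).support, x ∈ (path h').support →
      (x = vert a ∨ x = vert b) ∧ (x = vert c ∨ x = vert d)

/-- `H` is an `r`-shallow topological minor of `G`: edges of `H` are mapped to paths of length at
most `2 * r + 1`. -/
def IsShallowTopMinor (r : ℕ) (H G : FinGraph.{u}) : Prop :=
  ∃ φ : TopMinorEmbedding H G, ∀ (a b : H.V) (h : H.graph.Adj a b), (φ.path h).length ≤ 2 * r + 1

/-- The density (number of edges divided by number of vertices) of a graph. -/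
noncomputable def density (H : FinGraph.{u}) : ℝ≥0∞ :=
  (H.graph.edgeSet.ncard : ℝ≥0∞) / (Nat.card H.V : ℝ≥0∞)

/-- The topologically greatest reduced average density of `G` at depth `r`: the largest density of
an `r`-shallow topological minor of `G`. -/
noncomputable def topGrad (r : ℕ) (G : FinGraph.{u}) : ℝ≥0∞ :=
  ⨆ (H : FinGraph.{u}) (_ : IsShallowTopMinor r H G), H.density

/-- The closed `r`-neighbourhood of `v`: the vertices at distance at most `r` from `v`, where the
distance of vertices in different components is infinite. -/
def closedNbhd {V : Type u} (G : SimpleGraph V) (r : ℕ) (v : V) : Set V :=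
  {w | G.edist w v ≤ (r : ℕ∞)}

/-- The `r`-neighbourhood complexity of `G`: the maximum, over all subgraphs `H` of `G` and all
nonempty sets `X` of vertices of `H`, of the number of distinct traces on `X` of closed
`r`-neighbourhoods (taken in `H`) of vertices of `H`, divided by the size of `X`. -/
noncomputable def nbhdComplexity (r : ℕ) (G : FinGraph.{u}) : ℝ≥0∞ :=
  ⨆ (H : G.graph.Subgraph) (X : Set H.verts) (_ : X.Nonempty),
    ((Set.range fun v : H.verts => closedNbhd H.coe r v ∩ X).ncard : ℝ≥0∞) / (X.ncard : ℝ≥0∞)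

/-- The top-grad at depth `r` of a graph class. -/
noncomputable def classTopGrad (r : ℕ) (𝒢 : Set FinGraph.{u}) : ℝ≥0∞ :=
  ⨆ G ∈ 𝒢, topGrad r G

/-- The `r`-neighbourhood complexity of a graph class. -/
noncomputable def classNbhdComplexity (r : ℕ) (𝒢 : Set FinGraph.{u}) : ℝ≥0∞ :=
  ⨆ G ∈ 𝒢, nbhdComplexity r G

/-- A graph class has bounded expansion if its top-grad at every depth `r` is at most `f r`, for
some real-valued function `f`. -/
def BoundedExpansion (𝒢 : Set FinGraph.{u}) : Prop :=
  ∃ f : ℕ → ℝ≥0, ∀ r : ℕ, classTopGrad r 𝒢 ≤ (f r : ℝ≥0∞)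

/-- A graph class has bounded neighbourhood complexity if its `r`-neighbourhood complexity is at
most `f r` for every `r`, for some real-valued function `f`. -/
def BoundedNbhdComplexity (𝒢 : Set FinGraph.{u}) : Prop :=
  ∃ f : ℕ → ℝ≥0, ∀ r : ℕ, classNbhdComplexity r 𝒢 ≤ (f r : ℝ≥0∞)

end FinGraph

/-! Bounded expansion gives linearly many traces through weak reachability. If every system of
internally disjoint short links on a set `T` has `O(|T|)` members, then each nonempty set `S`
contains a vertex that boundedly many vertices separate from the rest of `S` at short distance
(`exists_separator`). Removing such vertices one by one yields an order with bounded weak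
reachability (`exists_order`, `card_wReach_le`). The minimum of a short walk from `v` to `X` is
weakly reachable from both ends, so a nonempty trace is encoded by one of `O(|X|)` vertices together
with a bounded amount of data (`ncard_traces_le`).

Conversely, the edges of a shallow topological minor are split by the exact length `l` of their
paths. Keeping only selected paths gives a subgraph of `G` in which the `l`-balls around branch
vertices cut out prescribed sets of neighbours in `X`. The bound on traces in subgraphs therefore
limits how many vertices can receive distinct sets of neighbours
(`traceBounded_of_nbhdComplexity_le`). An extremal choice of `X` turns this into bounded degeneracy
(`TraceBounded.exists_low_degree`), and summing over `l ≤ 2r+1` bounds the number of edges. -/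

namespace FinGraph

/-! ### Systems of disjoint links and small separators. -/

section Links

variable {V : Type*} {G : SimpleGraph V}

/-- `I` is the set of inner vertices of a path of length at most `k` from `a` to `b`. -/
def IsLink (G : SimpleGraph V) (k : ℕ) (a b : V) (I : Finset V) : Prop :=
  ∃ p : G.Walk a b, p.IsPath ∧ p.length ≤ k ∧ ∀ x, x ∈ I ↔ x ∈ p.support ∧ x ≠ a ∧ x ≠ b

lemma IsLink.mono {k l : ℕ} {a b : V} {I : Finset V} (h : IsLink G k a b I) (hkl : k ≤ l) :
    IsLink G l a b I := by
  obtain ⟨p, hp, hl, hI⟩ := h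
  exact ⟨p, hp, hl.trans hkl, hI⟩

lemma IsLink.symm {k : ℕ} {a b : V} {I : Finset V} (h : IsLink G k a b I) :
    IsLink G k b a I := by
  obtain ⟨p, hp, hl, hI⟩ := h
  refine ⟨p.reverse, hp.reverse, by simpa using hl, fun x => ?_⟩
  rw [hI]
  simp [and_comm]

lemma IsLink.card_le {k : ℕ} {a b : V} {I : Finset V} (h : IsLink G k a b I) : I.card ≤ k := by
  classical
  obtain ⟨p, -, hl, hI⟩ := h
  have h1 : insert a I ⊆ p.support.toFinset := by
    intro x hx
    rcases Finset.mem_insert.1 hx with rfl | hx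
    · simp
    · simpa using ((hI x).1 hx).1
  have h2 : (insert a I).card = I.card + 1 := by
    apply Finset.card_insert_of_notMem
    intro ha
    exact ((hI a).1 ha).2.1 rfl
  have h3 := Finset.card_le_card h1
  have h4 := p.support.toFinset_card_le
  rw [SimpleGraph.Walk.length_support] at h4
  omega

/-- Cut a walk between distinct vertices of `T` at its first return to `T`. -/
lemma exists_isLink_of_walk (T : Finset V) {v w : V} (hw : w ∈ T) (hvw : w ≠ v) (p : G.Walk v w) :
    ∃ y ∈ T, y ≠ v ∧ y ∈ p.support ∧ ∃ I : Finset V, IsLink G p.length v y I ∧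
      (∀ x ∈ I, x ∈ p.support ∧ x ∉ T) := by
  classical
  induction hn : p.length using Nat.strong_induction_on generalizing w with
  | _ n ih =>
    by_cases h : ∃ x ∈ p.support, x ∈ T ∧ x ≠ v ∧ x ≠ w
    · obtain ⟨x, hx, hxT, hxv, hxw⟩ := h
      have hlt := SimpleGraph.Walk.length_takeUntil_lt_length hx hxw
      obtain ⟨y, hyT, hyv, hyp, I, hI, hIs⟩ := ih _ (hn ▸ hlt) hxT hxv (p.takeUntil x hx) rfl
      exact ⟨y, hyT, hyv, p.support_takeUntil_subset_support hx hyp, I,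
        hI.mono (hlt.le.trans hn.le),
        fun z hz => ⟨p.support_takeUntil_subset_support hx (hIs z hz).1, (hIs z hz).2⟩⟩
    · push Not at h
      refine ⟨w, hw, hvw, p.end_mem_support,
        p.bypass.support.toFinset.filter (fun x => x ≠ v ∧ x ≠ w),
        ⟨p.bypass, p.bypass_isPath, hn ▸ p.length_bypass_le_length, fun x => by simp⟩, fun x hx => ?_⟩
      simp only [Finset.mem_filter, List.mem_toFinset] at hx
      have := p.support_bypass_subset_support hx.1
      exact ⟨this, fun hT => hx.2.2 (h x this hT hx.2.1)⟩

lemma IsLink.exists_walk_of_mem {k : ℕ} {a b : V} {I : Finset V} (h : IsLink G k a b I) {x : V}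
    (hx : x ∈ I) : ∃ p : G.Walk a x, p.length ≤ k ∧ ∀ z ∈ p.support, z = a ∨ z ∈ I := by
  classical
  obtain ⟨p, hp, hl, hI⟩ := h
  obtain ⟨hxp, hxa, hxb⟩ := (hI x).1 hx
  refine ⟨p.takeUntil x hxp, (p.length_takeUntil_le_length hxp).trans hl, fun z hz => ?_⟩
  by_cases hza : z = a
  · exact Or.inl hza
  · refine Or.inr ((hI z).2 ⟨p.support_takeUntil_subset_support hxp hz, hza, ?_⟩)
    rintro rfl
    exact SimpleGraph.Walk.endpoint_notMem_support_takeUntil hp hxp hxb.symm hz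

/-- Two links with a common inner vertex yield a link between their first ends. -/
lemma IsLink.join {k l : ℕ} {a b c d : V} {I J : Finset V} (h : IsLink G k a b I)
    (h' : IsLink G l c d J) {x : V} (hx : x ∈ I) (hx' : x ∈ J) :
    ∃ K : Finset V, IsLink G (k + l) a c K ∧ ∀ z ∈ K, z ∈ I ∨ z ∈ J := by
  classical
  obtain ⟨p, hpl, hp⟩ := h.exists_walk_of_mem hx
  obtain ⟨q, hql, hq⟩ := h'.exists_walk_of_mem hx'
  let w := p.append q.reverse
  refine ⟨w.bypass.support.toFinset.filter (fun x => x ≠ a ∧ x ≠ c),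
    ⟨w.bypass, w.bypass_isPath, w.length_bypass_le_length.trans ?_, fun x => by simp⟩, ?_⟩
  · simp [w]; omega
  · intro z hz
    simp only [Finset.mem_filter, List.mem_toFinset] at hz
    have hzw := w.support_bypass_subset_support hz.1
    rw [SimpleGraph.Walk.mem_support_append_iff, SimpleGraph.Walk.support_reverse,
      List.mem_reverse] at hzw
    rcases hzw with hz' | hz'
    · exact Or.inl ((hp z hz').resolve_left hz.2.1)
    · exact Or.inr ((hq z hz').resolve_left hz.2.2)

/-- A family of internally disjoint links between distinct pairs of vertices of `T`, whose inner
vertices are outside `T`. -/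
structure LinkSystem (G : SimpleGraph V) (k : ℕ) (T : Finset V)
    (F : Finset (V × V × Finset V)) : Prop where
  left_mem : ∀ t ∈ F, t.1 ∈ T
  right_mem : ∀ t ∈ F, t.2.1 ∈ T
  ne : ∀ t ∈ F, t.1 ≠ t.2.1
  isLink : ∀ t ∈ F, IsLink G k t.1 t.2.1 t.2.2
  disjoint_ends : ∀ t ∈ F, ∀ x ∈ t.2.2, x ∉ T
  pair_ne : ∀ t ∈ F, ∀ t' ∈ F, t ≠ t' → s(t.1, t.2.1) ≠ s(t'.1, t'.2.1)
  disjoint : ∀ t ∈ F, ∀ t' ∈ F, t ≠ t' → ∀ x ∈ t.2.2, x ∉ t'.2.2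

/-- Every system of links of length at most `k` on `T` has at most `c * |T|` members. -/
def LinkSparse (G : SimpleGraph V) (k c : ℕ) : Prop :=
  ∀ T F, LinkSystem G k T F → F.card ≤ c * T.card

lemma LinkSystem.insert [DecidableEq V] {k : ℕ} {T : Finset V} {F : Finset (V × V × Finset V)}
    (hF : LinkSystem G k T F) {a b : V} {I : Finset V} (ha : a ∈ T) (hb : b ∈ T) (hab : a ≠ b)
    (hI : IsLink G k a b I) (hIT : ∀ x ∈ I, x ∉ T)
    (hpair : ∀ t ∈ F, s(t.1, t.2.1) ≠ s(a, b)) (hdisj : ∀ t ∈ F, ∀ x ∈ I, x ∉ t.2.2) :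
    LinkSystem G k T (insert (a, b, I) F) ∧ (a, b, I) ∉ F := by
  refine ⟨⟨?_, ?_, ?_, ?_, ?_, ?_, ?_⟩, fun h => hpair _ h rfl⟩
  · simpa using ⟨ha, fun a b I h => hF.left_mem _ h⟩
  · simpa using ⟨hb, fun a b I h => hF.right_mem _ h⟩
  · simpa using ⟨hab, fun a b I h => hF.ne _ h⟩
  · simpa using ⟨hI, fun a b I h => hF.isLink _ h⟩
  · intro t ht
    rcases Finset.mem_insert.1 ht with rfl | ht
    exacts [hIT, hF.disjoint_ends t ht]
  · intro t ht t' ht' hne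
    rcases Finset.mem_insert.1 ht with rfl | ht <;> rcases Finset.mem_insert.1 ht' with rfl | ht'
    exacts [absurd rfl hne, (hpair _ ht').symm, hpair _ ht, hF.pair_ne t ht t' ht' hne]
  · intro t ht t' ht' hne
    rcases Finset.mem_insert.1 ht with rfl | ht <;> rcases Finset.mem_insert.1 ht' with rfl | ht'
    exacts [absurd rfl hne, hdisj _ ht', fun x hx hx' => hdisj _ ht x hx' hx,
      hF.disjoint t ht t' ht' hne]

lemma LinkSystem.subset {k : ℕ} {T T' : Finset V} {F F' : Finset (V × V × Finset V)}
    (hF : LinkSystem G k T F) (hT : T' ⊆ T) (hF' : F' ⊆ F)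
    (hl : ∀ t ∈ F', t.1 ∈ T') (hr : ∀ t ∈ F', t.2.1 ∈ T') : LinkSystem G k T' F' where
  left_mem := hl
  right_mem := hr
  ne t ht := hF.ne t (hF' ht)
  isLink t ht := hF.isLink t (hF' ht)
  disjoint_ends t ht x hx hx' := hF.disjoint_ends t (hF' ht) x hx (hT hx')
  pair_ne t ht t' ht' := hF.pair_ne t (hF' ht) t' (hF' ht')
  disjoint t ht t' ht' := hF.disjoint t (hF' ht) t' (hF' ht')

lemma LinkSystem.empty (G : SimpleGraph V) (k : ℕ) (T : Finset V) : LinkSystem G k T ∅ := by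
  constructor <;> simp

/-- Greedy independent sets in degenerate graphs. -/
lemma exists_independent_of_degenerate [DecidableEq V] (r : V → V → Prop) [DecidableRel r]
    (hr : ∀ a b, r a b → r b a) (hirr : ∀ a, ¬ r a a) (d : ℕ) (S : Finset V)
    (h : ∀ S' ⊆ S, S'.Nonempty → ∃ v ∈ S', (S'.filter (r v)).card ≤ d) :
    ∃ R ⊆ S, (∀ a ∈ R, ∀ b ∈ R, ¬ r a b) ∧ S.card ≤ (d + 1) * R.card := by
  induction hn : S.card using Nat.strong_induction_on generalizing S with
  | _ n ih =>
    rcases S.eq_empty_or_nonempty with rfl | hS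
    · exact ⟨∅, by simp, by simp, by simp [← hn]⟩
    obtain ⟨v, hv, hd⟩ := h S subset_rfl hS
    set S' := (S.filter (fun w => ¬ r v w)).erase v with hS'
    have hsub : S' ⊆ S := (Finset.erase_subset _ _).trans (Finset.filter_subset _ _)
    have hvS' : v ∉ S' := by simp [S']
    have hlt : S'.card < n := by
      rw [← hn]
      exact Finset.card_lt_card (Finset.ssubset_iff_subset_ne.2 ⟨hsub, fun he => hvS' (he ▸ hv)⟩)
    obtain ⟨R, hRS, hR, hc⟩ := ih _ hlt S' (fun S'' hs => h S'' (hs.trans hsub)) rfl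
    have hvR : v ∉ R := fun hvR => hvS' (hRS hvR)
    have key : ∀ b ∈ R, ¬ r v b := fun b hb => by
      have := hRS hb
      simp only [S', Finset.mem_erase, Finset.mem_filter] at this
      exact this.2.2
    refine ⟨insert v R, Finset.insert_subset hv (hRS.trans hsub), ?_, ?_⟩
    · intro a ha b hb
      rcases Finset.mem_insert.1 ha with rfl | ha' <;> rcases Finset.mem_insert.1 hb with rfl | hb'
      exacts [hirr _, key b hb', fun hab => key a ha' (hr _ _ hab), hR a ha' b hb']
    · rw [Finset.card_insert_of_notMem hvR]
      have h1 : S'.card + 1 = (S.filter (fun w => ¬ r v w)).card :=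
        Finset.card_erase_add_one (by simp [hv, hirr])
      have h2 := Finset.card_filter_add_card_filter_not (s := S) (r v)
      rw [mul_add]
      omega

/-- In the graph of a link system some vertex of every subset has low degree. -/
lemma LinkSystem.exists_low_degree [DecidableEq V] {k c : ℕ} (hG : LinkSparse G k c)
    {T : Finset V} {F : Finset (V × V × Finset V)} (hF : LinkSystem G k T F) {S : Finset V}
    (hST : S ⊆ T) (hS : S.Nonempty) :
    ∃ v ∈ S, (S.filter (fun w => ∃ t ∈ F, s(t.1, t.2.1) = s(v, w))).card ≤ 2 * c := by
  by_contra! hcon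
  let F' := F.filter (fun t => t.1 ∈ S ∧ t.2.1 ∈ S)
  have hF' : LinkSystem G k S F' := hF.subset hST (Finset.filter_subset _ _)
    (fun t ht => (Finset.mem_filter.1 ht).2.1) (fun t ht => (Finset.mem_filter.1 ht).2.2)
  have h1 := hG S F' hF'
  have h2 : S.card * (2 * c + 1) ≤
      ∑ v ∈ S, (S.filter (fun w => ∃ t ∈ F, s(t.1, t.2.1) = s(v, w))).card := by
    rw [← smul_eq_mul]
    exact Finset.card_nsmul_le_sum _ _ _ (fun v hv => hcon v hv)
  rw [← Finset.card_sigma] at h2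
  -- Each link inside `S` accounts for at most two ordered pairs, so the degree sum is at most `2 *
  -- c * |S|`.
  have h3 : (S.sigma (fun v => S.filter (fun w => ∃ t ∈ F, s(t.1, t.2.1) = s(v, w)))).card ≤
      (F'.image (fun t => (⟨t.1, t.2.1⟩ : Σ _ : V, V)) ∪
        F'.image (fun t => (⟨t.2.1, t.1⟩ : Σ _ : V, V))).card := by
    apply Finset.card_le_card
    rintro ⟨v, w⟩ hvw
    simp only [Finset.mem_sigma, Finset.mem_filter] at hvw
    obtain ⟨hv, hw, t, ht, he⟩ := hvw
    rw [Finset.mem_union, Finset.mem_image, Finset.mem_image]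
    rcases Sym2.eq_iff.1 he with ⟨rfl, rfl⟩ | ⟨rfl, rfl⟩
    · exact Or.inl ⟨t, Finset.mem_filter.2 ⟨ht, hv, hw⟩, rfl⟩
    · exact Or.inr ⟨t, Finset.mem_filter.2 ⟨ht, hw, hv⟩, rfl⟩
  have h4 := h3.trans (Finset.card_union_le _ _)
  have h5 := Finset.card_image_le (s := F') (f := fun t => (⟨t.1, t.2.1⟩ : Σ _ : V, V))
  have h6 := Finset.card_image_le (s := F') (f := fun t => (⟨t.2.1, t.1⟩ : Σ _ : V, V))
  have := hS.card_pos
  nlinarith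

/-- A bound for the size of the separators of `exists_separator`. -/
def sepBound (r c : ℕ) : ℕ := c * (1 + c * (2 * r + 1)) * (2 * c + 1) * (r + 1)

/-- Two extremal systems are used. A maximal system `F` on `S` leaves a large independent set `R`
whose vertices cannot be linked outside `T`. A maximal system `F'` of links from `R` to `T \ R` has
`O(|R|)` members, so some `v ∈ R` starts few of them. Their inner vertices and far ends form `Z`: a
short walk missing `Z` would extend `F'` or link two vertices of `R`. -/
theorem exists_separator [Finite V] {r c : ℕ} (hG : LinkSparse G (2 * r + 1) c) {S : Finset V}
    (hS : S.Nonempty) :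
    ∃ v ∈ S, ∃ Z : Finset V, v ∉ Z ∧ Z.card ≤ sepBound r c ∧
      ∀ w ∈ S, w ≠ v → ∀ p : G.Walk v w, p.length ≤ r → ∃ z ∈ Z, z ∈ p.support := by
  classical
  have := Fintype.ofFinite V
  obtain ⟨F, hF, hFmax⟩ := Finset.exists_max_image
    (Finset.univ.filter fun F : Finset (V × V × Finset V) => LinkSystem G (2 * r + 1) S F)
    Finset.card ⟨∅, by simpa using LinkSystem.empty G _ S⟩
  simp only [Finset.mem_filter, Finset.mem_univ, true_and] at hF hFmax
  let M := F.biUnion (fun t => t.2.2)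
  have hM : M.card ≤ (c * S.card) * (2 * r + 1) :=
    (Finset.card_biUnion_le_card_mul _ _ _ fun t ht => (hF.isLink t ht).card_le).trans
      (Nat.mul_le_mul_right _ (hG S F hF))
  obtain ⟨R, hRS, hR, hRc⟩ := exists_independent_of_degenerate
    (fun a b => ∃ t ∈ F, s(t.1, t.2.1) = s(a, b))
    (fun a b ⟨t, ht, h⟩ => ⟨t, ht, h.trans Sym2.eq_swap⟩)
    (fun a ⟨t, ht, h⟩ => hF.ne t ht (by rcases Sym2.eq_iff.1 h with ⟨h, h'⟩ | ⟨h, h'⟩ <;> rw [h, h']))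
    (2 * c) S (fun S' hS' hne => hF.exists_low_degree hG hS' hne)
  have hRne : R.Nonempty := by
    rw [Finset.nonempty_iff_ne_empty]
    rintro rfl
    have := hS.card_pos
    rw [Finset.card_empty, mul_zero] at hRc
    omega
  let T := S ∪ M
  have hRT : R ⊆ T := hRS.trans Finset.subset_union_left
  -- no link between two vertices of `R` avoids `T`
  have hno : ∀ a ∈ R, ∀ b ∈ R, a ≠ b → ∀ I, IsLink G (2 * r + 1) a b I → ¬ ∀ x ∈ I, x ∉ T := by
    intro a ha b hb hab I hI hIT
    obtain ⟨h1, h2⟩ := hF.insert (hRS ha) (hRS hb) hab hI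
      (fun x hx hxS => hIT x hx (Finset.mem_union_left _ hxS))
      (fun t ht h => hR a ha b hb ⟨t, ht, h⟩)
      (fun t ht x hx hxt => hIT x hx
        (Finset.mem_union_right _ (Finset.mem_biUnion.2 ⟨t, ht, hxt⟩)))
    have := hFmax _ h1
    rw [Finset.card_insert_of_notMem h2] at this
    omega
  obtain ⟨F', hF', hFmax'⟩ := Finset.exists_max_image
    (Finset.univ.filter fun F : Finset (V × V × Finset V) =>
      LinkSystem G r T F ∧ ∀ t ∈ F, t.1 ∈ R ∧ t.2.1 ∉ R)
    Finset.card ⟨∅, by simpa using LinkSystem.empty G _ T⟩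
  simp only [Finset.mem_filter, Finset.mem_univ, true_and] at hF' hFmax'
  obtain ⟨hF', hFR⟩ := hF'
  have hc' : F'.card ≤ c * T.card := hG T F'
    { hF' with isLink := fun t ht => (hF'.isLink t ht).mono (by omega) }
  let L := c * (1 + c * (2 * r + 1)) * (2 * c + 1)
  have hL : F'.card ≤ L * R.card := by
    have h1 : T.card ≤ S.card + c * S.card * (2 * r + 1) :=
      (Finset.card_union_le _ _).trans (by omega)
    calc F'.card ≤ c * (S.card + c * S.card * (2 * r + 1)) :=
          hc'.trans (Nat.mul_le_mul_left _ h1)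
      _ = c * (1 + c * (2 * r + 1)) * S.card := by ring
      _ ≤ c * (1 + c * (2 * r + 1)) * ((2 * c + 1) * R.card) := Nat.mul_le_mul_left _ hRc
      _ = L * R.card := by simp only [L]; ring
  obtain ⟨v, hv, hvL⟩ : ∃ v ∈ R, (F'.filter fun t => t.1 = v).card ≤ L := by
    by_contra! hcon
    have h1 := Finset.card_eq_sum_card_fiberwise (f := fun t => t.1) (s := F') (t := R)
      (fun t ht => (hFR t ht).1)
    have h2 : R.card * (L + 1) ≤ ∑ v ∈ R, (F'.filter fun t => t.1 = v).card := by
      rw [← smul_eq_mul]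
      exact Finset.card_nsmul_le_sum _ _ _ (fun v hv => hcon v hv)
    have := hRne.card_pos
    nlinarith
  refine ⟨v, hRS hv, (F'.filter fun t => t.1 = v).biUnion (fun t => insert t.2.1 t.2.2),
    ?_, ?_, ?_⟩
  · simp only [Finset.mem_biUnion, Finset.mem_filter, Finset.mem_insert, not_exists, not_and]
    rintro t ⟨ht, rfl⟩ (h | h)
    · exact hF'.ne t ht h
    · exact hF'.disjoint_ends t ht _ h (hF'.left_mem t ht)
  · refine (Finset.card_biUnion_le_card_mul _ _ (r + 1) fun t ht => ?_).trans
      (Nat.mul_le_mul_right _ hvL)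
    exact (Finset.card_insert_le _ _).trans
      (Nat.succ_le_succ (hF'.isLink t (Finset.mem_filter.1 ht).1).card_le)
  · intro w hw hwv p hp
    by_contra! hZ
    have hZ' : ∀ t ∈ F', t.1 = v → ∀ z ∈ p.support, z ≠ t.2.1 ∧ z ∉ t.2.2 := by
      intro t ht htv z hz
      have := hZ z
      simp only [Finset.mem_biUnion, Finset.mem_filter, Finset.mem_insert] at this
      constructor
      · intro h
        exact this ⟨t, ⟨ht, htv⟩, Or.inl h⟩ hz
      · intro h
        exact this ⟨t, ⟨ht, htv⟩, Or.inr h⟩ hz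
    obtain ⟨y, hyT, hyv, hyp, I, hI, hIp⟩ :=
      exists_isLink_of_walk T (Finset.mem_union_left M hw) hwv p
    have hyR : y ∉ R := fun hyR => hno v hv y hyR hyv.symm I (hI.mono (by omega))
      (fun x hx => (hIp x hx).2)
    obtain ⟨h1, h2⟩ := hF'.insert (hRT hv) hyT hyv.symm (hI.mono hp) (fun x hx => (hIp x hx).2)
      (fun t ht h => by
        rcases Sym2.eq_iff.1 h with ⟨h, h'⟩ | ⟨h, h'⟩
        · exact (hZ' t ht h y hyp).1 h'.symm
        · exact hyR (h ▸ (hFR t ht).1))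
      (fun t ht x hx hxt => by
        have htv : t.1 ≠ v := fun h => (hZ' t ht h x (hIp x hx).1).2 hxt
        -- If the new link crosses a link of `F'` starting at another vertex of `R`, the two join
        -- into a link of length at most `2 * r` inside `R`. This is why `F` admits links longer
        -- than `r`.
        obtain ⟨K, hK, hKs⟩ := hI.join (hF'.isLink t ht) hx hxt
        refine hno v hv t.1 (hFR t ht).1 htv.symm K (hK.mono (by omega)) fun z hz => ?_
        rcases hKs z hz with hz | hz
        · exact (hIp z hz).2
        · exact hF'.disjoint_ends t ht z hz)
    have := hFmax' _ ⟨h1, by simpa using ⟨⟨hv, hyR⟩, fun a b I h => hFR _ h⟩⟩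
    rw [Finset.card_insert_of_notMem h2] at this
    omega

end Links

/-! ### Vertex orders, weak reachability and counting traces. -/

section WeakReach

variable {V : Type*} {G : SimpleGraph V}

/-- The vertex order given by `f` has small separators: walks of length at most `r` from `v` to
smaller vertices are hit by a set of at most `m` vertices different from `v`. -/
def HasSeparators (G : SimpleGraph V) (r m : ℕ) (f : V → ℕ) : Prop :=
  ∀ v, ∃ Z : Finset V, v ∉ Z ∧ Z.card ≤ m ∧
    ∀ w, f w < f v → ∀ p : G.Walk v w, p.length ≤ r → ∃ z ∈ Z, z ∈ p.support

/-- The separated vertex of the current set is made its largest element and the rest is ordered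
recursively, so the vertices below `v` are those still present when `v` is removed. -/
theorem exists_order [Finite V] {r c : ℕ} (hG : LinkSparse G (2 * r + 1) c) :
    ∃ f : V → ℕ, Function.Injective f ∧ HasSeparators G r (sepBound r c) f := by
  classical
  have := Fintype.ofFinite V
  suffices h : ∀ n, ∀ S : Finset V, S.card = n → ∃ f : V → ℕ, Set.InjOn f S ∧
      ∀ v ∈ S, ∃ Z : Finset V, v ∉ Z ∧ Z.card ≤ sepBound r c ∧
        ∀ w ∈ S, f w < f v → ∀ p : G.Walk v w, p.length ≤ r → ∃ z ∈ Z, z ∈ p.support by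
    obtain ⟨f, hf, hZ⟩ := h _ Finset.univ rfl
    exact ⟨f, by simpa using hf, fun v => by simpa using hZ v (Finset.mem_univ v)⟩
  intro n
  induction n with
  | zero =>
    intro S hS
    rw [Finset.card_eq_zero] at hS
    subst hS
    exact ⟨fun _ => 0, by simp, by simp⟩
  | succ n ih =>
    intro S hS
    obtain ⟨v, hv, Z, hvZ, hZc, hZ⟩ := exists_separator hG (Finset.card_pos.1 (by omega : 0 < S.card))
    obtain ⟨f, hf, hfZ⟩ := ih (S.erase v) (by rw [Finset.card_erase_of_mem hv]; omega)
    let g : V → ℕ := fun x => if x = v then S.sup f + 1 else f x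
    have hgv : g v = S.sup f + 1 := if_pos rfl
    have hg : ∀ x, x ≠ v → g x = f x := fun x hx => if_neg hx
    have hlt : ∀ x ∈ S, x ≠ v → g x < g v := fun x hx hxv => by
      rw [hg x hxv, hgv]
      exact Nat.lt_succ_of_le (Finset.le_sup hx)
    refine ⟨g, ?_, ?_⟩
    · intro x hx y hy hxy
      by_cases hxv : x = v <;> by_cases hyv : y = v
      · rw [hxv, hyv]
      · subst hxv
        exact absurd hxy (hlt y hy hyv).ne'
      · subst hyv
        exact absurd hxy (hlt x hx hxv).ne
      · rw [hg x hxv, hg y hyv] at hxy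
        exact hf (by simpa [hxv] using hx) (by simpa [hyv] using hy) hxy
    · intro x hx
      by_cases hxv : x = v
      · subst hxv
        refine ⟨Z, hvZ, hZc, fun w hw hwx => hZ w hw ?_⟩
        rintro rfl
        exact lt_irrefl _ hwx
      · obtain ⟨Z', h1, h2, h3⟩ := hfZ x (by simp [hxv, hx])
        refine ⟨Z', h1, h2, fun w hw hwx => ?_⟩
        have hwv : w ≠ v := by
          rintro rfl
          exact absurd (hlt x hx hxv) hwx.not_gt
        exact h3 w (by simp [hwv, hw]) (by rwa [hg x hxv, hg w hwv] at hwx)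

/-- `w` is weakly `k`-reachable from `v`: it is the smallest vertex of a walk of length at most `k`
from `v`. -/
def WReach (G : SimpleGraph V) (f : V → ℕ) (k : ℕ) (v w : V) : Prop :=
  ∃ p : G.Walk v w, p.length ≤ k ∧ ∀ x ∈ p.support, f w ≤ f x

-- A walk from `v` down to a smaller vertex meets the separator at some `z ≠ v`, and its part after
-- `z` is strictly shorter. This gives the recursion `1 + m * (m + 1) ^ k ≤ (m + 1) ^ (k + 1)`.
open Classical in
theorem card_wReach_le [Fintype V] {r m : ℕ} {f : V → ℕ} (hf : Function.Injective f)
    (h : HasSeparators G r m f) {k : ℕ} (hk : k ≤ r) (v : V) :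
    (Finset.univ.filter (WReach G f k v)).card ≤ (m + 1) ^ k := by
  induction k generalizing v with
  | zero =>
    rw [pow_zero, Finset.card_le_one]
    have : ∀ w, WReach G f 0 v w → w = v := by
      rintro w ⟨p, hp, -⟩
      exact (SimpleGraph.Walk.eq_of_length_eq_zero (Nat.le_zero.1 hp)).symm
    intro a ha b hb
    rw [this a (Finset.mem_filter.1 ha).2, this b (Finset.mem_filter.1 hb).2]
  | succ k ih =>
    obtain ⟨Z, hvZ, hZc, hZ⟩ := h v
    have hsub : Finset.univ.filter (WReach G f (k + 1) v) ⊆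
        insert v (Z.biUnion fun z => Finset.univ.filter (WReach G f k z)) := by
      intro w hw
      obtain ⟨p, hp, hmin⟩ := (Finset.mem_filter.1 hw).2
      rw [Finset.mem_insert]
      by_cases hwv : w = v
      · exact Or.inl hwv
      right
      have hlt : f w < f v := lt_of_le_of_ne (hmin v p.start_mem_support) (fun e => hwv (hf e))
      obtain ⟨z, hz, hzp⟩ := hZ w hlt p (hp.trans hk)
      have hzv : v ≠ z := by rintro rfl; exact hvZ hz
      refine Finset.mem_biUnion.2 ⟨z, hz, Finset.mem_filter.2 ⟨Finset.mem_univ _,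
        p.dropUntil z hzp, ?_, fun x hx => hmin x (p.support_dropUntil_subset_support hzp hx)⟩⟩
      have h1 := congrArg SimpleGraph.Walk.length (p.take_spec hzp)
      rw [SimpleGraph.Walk.length_append] at h1
      have h2 : (p.takeUntil z hzp).length ≠ 0 := fun h0 =>
        hzv (SimpleGraph.Walk.eq_of_length_eq_zero h0)
      omega
    have h1 := (Finset.card_le_card hsub).trans (Finset.card_insert_le _ _)
    have h2 := Finset.card_biUnion_le_card_mul Z (fun z => Finset.univ.filter (WReach G f k z))
      ((m + 1) ^ k) (fun z _ => ih (by omega) z)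
    have h3 := Nat.mul_le_mul_right ((m + 1) ^ k) hZc
    have h4 : 0 < (m + 1) ^ k := by positivity
    rw [pow_succ, mul_add, mul_comm _ m]
    omega

lemma mem_closedNbhd_iff {r : ℕ} {v w : V} :
    w ∈ closedNbhd G r v ↔ ∃ p : G.Walk w v, p.length ≤ r := by
  constructor
  · intro h
    have h' : G.edist w v ≤ (r : ℕ∞) := h
    obtain ⟨p, hp⟩ := SimpleGraph.exists_walk_of_edist_ne_top
      (ne_top_of_le_ne_top (ENat.natCast_ne_top r) h')
    exact ⟨p, by rw [← hp] at h'; exact_mod_cast h'⟩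
  · rintro ⟨p, hp⟩
    exact (SimpleGraph.edist_le p).trans (by exact_mod_cast hp)

/-- The number of traces of closed `r`-neighbourhoods is linear, given a good vertex order. -/
theorem ncard_traces_le [Finite V] {r m : ℕ} {f : V → ℕ} (hf : Function.Injective f)
    (h : HasSeparators G (2 * r) m f) (X : Set V) (hX : X.Nonempty) :
    (Set.range fun v => closedNbhd G r v ∩ X).ncard ≤
      (1 + (m + 1) ^ r * 2 ^ ((m + 1) ^ (2 * r) * (r + 1))) * X.ncard := by
  classical
  have := Fintype.ofFinite V
  let W : ℕ → V → Finset V := fun k v => Finset.univ.filter (WReach G f k v)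
  have hW : ∀ k v w, w ∈ W k v ↔ WReach G f k v w := fun k v w => by simp [W]
  let Y := X.toFinset.biUnion (W r)
  have hY : Y.card ≤ X.ncard * (m + 1) ^ r := by
    rw [Set.ncard_eq_toFinset_card']
    exact Finset.card_biUnion_le_card_mul _ _ _ fun x _ => card_wReach_le hf h (by omega) x
  -- Rebuilds a trace from pairs (vertex `s`, bound on the length of a walk from the centre to `s`).
  let Tr : Finset (V × ℕ) → Set V := fun A =>
    {x | x ∈ X ∧ ∃ s ∈ A, ∃ q : G.Walk s.1 x, s.2 + q.length ≤ r}
  let C : Finset (Set V) :=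
    insert ∅ (Y.biUnion fun y => (W (2 * r) y ×ˢ Finset.range (r + 1)).powerset.image Tr)
  have hsub : (Set.range fun v => closedNbhd G r v ∩ X) ⊆ (C : Set (Set V)) := by
    rintro _ ⟨v, rfl⟩
    rw [Finset.mem_coe, Finset.mem_insert]
    rcases (closedNbhd G r v ∩ X).eq_empty_or_nonempty with he | ⟨x₀, hx₀, hx₀X⟩
    · exact Or.inl he
    right
    have key : ∀ x ∈ X, x ∈ closedNbhd G r v → ∃ s ∈ W r v, s ∈ Y ∧
        ∃ (p : G.Walk v s) (q : G.Walk s x), p.length + q.length ≤ r := by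
      intro x hxX hx
      obtain ⟨p', hp'⟩ := mem_closedNbhd_iff.1 hx
      obtain ⟨p, hp⟩ : ∃ p : G.Walk v x, p.length ≤ r := ⟨p'.reverse, by simpa using hp'⟩
      obtain ⟨s, hs, hmin⟩ := Finset.exists_min_image p.support.toFinset f ⟨v, by simp⟩
      simp only [List.mem_toFinset] at hs hmin
      have hl := congrArg SimpleGraph.Walk.length (p.take_spec hs)
      rw [SimpleGraph.Walk.length_append] at hl
      refine ⟨s, (hW _ _ _).2 ⟨p.takeUntil s hs, by omega, fun y hy =>
        hmin y (p.support_takeUntil_subset_support hs hy)⟩, ?_, p.takeUntil s hs, p.dropUntil s hs,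
        by omega⟩
      refine Finset.mem_biUnion.2 ⟨x, by simpa using hxX, (hW _ _ _).2
        ⟨(p.dropUntil s hs).reverse, by rw [SimpleGraph.Walk.length_reverse]; omega,
          fun y hy => hmin y (p.support_dropUntil_subset_support hs ?_)⟩⟩
      simpa using hy
    obtain ⟨s₀, hs₀, hs₀Y, -⟩ := key x₀ hx₀X hx₀
    -- For the largest relevant `y`, every other relevant `s` is weakly `2 * r`-reachable from `y`
    -- by going through `v`. The code is then a subset of a set that depends on `y` alone, not on
    -- `v`.
    obtain ⟨y, hy, hmax⟩ := Finset.exists_max_image (W r v ∩ Y) f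
      ⟨s₀, Finset.mem_inter.2 ⟨hs₀, hs₀Y⟩⟩
    rw [Finset.mem_inter] at hy
    refine Finset.mem_biUnion.2 ⟨y, hy.2, Finset.mem_image.2
      ⟨(W (2 * r) y ×ˢ Finset.range (r + 1)).filter
        (fun s => ∃ p : G.Walk v s.1, p.length ≤ s.2), Finset.mem_powerset.2
        (Finset.filter_subset _ _), ?_⟩⟩
    ext x
    constructor
    · rintro ⟨hxX, s, hs, q, hq⟩
      obtain ⟨p, hp⟩ := (Finset.mem_filter.1 hs).2
      refine ⟨mem_closedNbhd_iff.2 ⟨(p.append q).reverse, ?_⟩, hxX⟩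
      rw [SimpleGraph.Walk.length_reverse, SimpleGraph.Walk.length_append]
      omega
    · rintro ⟨hx, hxX⟩
      obtain ⟨s, hs, hsY, p, q, hpq⟩ := key x hxX hx
      refine ⟨hxX, (s, p.length), Finset.mem_filter.2 ⟨Finset.mem_product.2 ⟨(hW _ _ _).2 ?_,
        Finset.mem_range.2 (by omega)⟩, p, le_rfl⟩, q, hpq⟩
      obtain ⟨a, ha, hamin⟩ := (hW _ _ _).1 hy.1
      obtain ⟨b, hb, hbmin⟩ := (hW _ _ _).1 hs
      have hsy := hmax s (Finset.mem_inter.2 ⟨hs, hsY⟩)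
      refine ⟨a.reverse.append b, ?_, fun z hz => ?_⟩
      · rw [SimpleGraph.Walk.length_append, SimpleGraph.Walk.length_reverse]
        omega
      · rw [SimpleGraph.Walk.mem_support_append_iff, SimpleGraph.Walk.support_reverse,
          List.mem_reverse] at hz
        rcases hz with hz | hz
        exacts [hsy.trans (hamin z hz), hbmin z hz]
  have h1 : (Set.range fun v => closedNbhd G r v ∩ X).ncard ≤ C.card := by
    rw [← Set.ncard_coe_finset]
    exact Set.ncard_le_ncard hsub C.finite_toSet
  have h2 : C.card ≤ Y.card * 2 ^ ((m + 1) ^ (2 * r) * (r + 1)) + 1 := by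
    refine (Finset.card_insert_le _ _).trans (Nat.succ_le_succ
      (Finset.card_biUnion_le_card_mul _ _ _ fun y _ => Finset.card_image_le.trans ?_))
    rw [Finset.card_powerset, Finset.card_product, Finset.card_range]
    exact Nat.pow_le_pow_right two_pos (Nat.mul_le_mul_right _ (card_wReach_le hf h le_rfl y))
  have h3 : 0 < X.ncard := (Set.ncard_pos (Set.toFinite X)).2 hX
  have h4 := Nat.mul_le_mul_right (2 ^ ((m + 1) ^ (2 * r) * (r + 1))) hY
  nlinarith

end WeakReach

/-! ### Link systems as shallow topological minors. -/

section Minors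

/-- The linked pairs of `F`, as a graph on `T`. -/
def linkGraph {V : Type*} (T : Finset V) (F : Finset (V × V × Finset V)) : SimpleGraph T where
  Adj a b := a ≠ b ∧ ∃ t ∈ F, s(t.1, t.2.1) = s(a.1, b.1)
  symm := ⟨fun _ _ ⟨h, t, ht, he⟩ => ⟨h.symm, t, ht, he.trans Sym2.eq_swap⟩⟩
  loopless := ⟨fun _ h => h.1 rfl⟩

/-- Construct a shallow topological minor from paths that are chosen independently for the two
directions of an edge, with disjoint sets of inner vertices. -/
lemma isShallowTopMinor_of_paths {r : ℕ} {H G : FinGraph.{u}} (vert : H.V → G.V)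
    (hvert : Function.Injective vert) (I : Sym2 H.V → Set G.V)
    (hpath : ∀ a b, H.graph.Adj a b → ∃ p : G.graph.Walk (vert a) (vert b), p.IsPath ∧
      p.length ≤ 2 * r + 1 ∧ ∀ x ∈ p.support, x = vert a ∨ x = vert b ∨ x ∈ I s(a, b))
    (hdisj : ∀ a b c d, H.graph.Adj a b → H.graph.Adj c d → s(a, b) ≠ s(c, d) →
      ∀ x ∈ I s(a, b), x ∉ I s(c, d))
    (hends : ∀ a b, H.graph.Adj a b → ∀ c, vert c ∉ I s(a, b)) :
    IsShallowTopMinor r H G := by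
  classical
  choose P hP using hpath
  obtain ⟨n, ⟨e⟩⟩ := @Finite.exists_equiv_fin H.V H.finite
  -- An enumeration of the vertices orients each edge, so that the two directions use one path and
  -- its reverse.
  let Q : ∀ {a b : H.V}, H.graph.Adj a b → G.graph.Walk (vert a) (vert b) := fun {a b} h =>
    if e a < e b then P a b h else (P b a h.symm).reverse
  have hQ : ∀ {a b : H.V} (h : H.graph.Adj a b), (Q h).IsPath ∧
      (Q h).length ≤ 2 * r + 1 ∧ ∀ x ∈ (Q h).support, x = vert a ∨ x = vert b ∨ x ∈ I s(a, b) := by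
    intro a b h
    by_cases hab : e a < e b
    · simp only [Q, if_pos hab]
      exact hP a b h
    · simp only [Q, if_neg hab]
      obtain ⟨h1, h2, h3⟩ := hP b a h.symm
      refine ⟨h1.reverse, by simpa using h2, fun x hx => ?_⟩
      rw [SimpleGraph.Walk.support_reverse, List.mem_reverse] at hx
      rw [Sym2.eq_swap]
      rcases h3 x hx with h | h | h
      exacts [Or.inr (Or.inl h), Or.inl h, Or.inr (Or.inr h)]
  refine ⟨⟨vert, hvert, Q, fun h => (hQ h).1, ?_, ?_⟩, fun a b h => (hQ h).2.1⟩
  · intro a b h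
    have hne : e a ≠ e b := fun he => h.ne (e.injective he)
    by_cases hab : e a < e b
    · simp only [Q, if_pos hab, if_neg hab.not_gt]
    · simp only [Q, if_neg hab, if_pos (lt_of_le_of_ne (not_lt.1 hab) hne.symm)]
      rw [SimpleGraph.Walk.reverse_reverse]
  · intro a b c d h h' hne x hx hx'
    have h1 := (hQ h).2.2 x hx
    have h2 := (hQ h').2.2 x hx'
    by_cases hxI : x ∈ I s(a, b)
    · rcases h2 with rfl | rfl | h2
      exacts [absurd hxI (hends a b h _), absurd hxI (hends a b h _),
        absurd h2 (hdisj a b c d h h' hne x hxI)]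
    · have h1' : x = vert a ∨ x = vert b := by tauto
      refine ⟨h1', ?_⟩
      rcases h2 with h2 | h2 | h2
      · exact Or.inl h2
      · exact Or.inr h2
      · rcases h1' with rfl | rfl
        exacts [absurd h2 (hends c d h' _), absurd h2 (hends c d h' _)]

/-- A link system on `T` is a topological minor model of a graph on `T` with one edge per link. The
injective homomorphism `φ` lets the bound pass to subgraphs of `G`. -/
theorem linkSparse_of_topGrad_le {r c : ℕ} {G : FinGraph.{u}} (hG : topGrad r G ≤ c)
    {V : Type u} {K : SimpleGraph V} (φ : K →g G.graph) (hφ : Function.Injective φ) :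
    LinkSparse K (2 * r + 1) c := by
  classical
  intro T F hF
  rcases T.eq_empty_or_nonempty with rfl | hT
  · have : F = ∅ := Finset.eq_empty_of_forall_notMem fun t ht => by simpa using hF.left_mem t ht
    simp [this]
  let H : FinGraph.{u} := ⟨T, hT.to_subtype, inferInstance, linkGraph T F⟩
  have hH : IsShallowTopMinor r H G := by
    refine isShallowTopMinor_of_paths (H := H) (fun a : T => φ a.1)
      (hφ.comp Subtype.val_injective)
      (fun e => {x | ∃ t ∈ F, s(t.1, t.2.1) = e.map Subtype.val ∧ ∃ z ∈ t.2.2, φ z = x}) ?_ ?_ ?_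
    · rintro ⟨a, ha⟩ ⟨b, hb⟩ ⟨-, t, ht, he⟩
      have hl : IsLink K (2 * r + 1) a b t.2.2 := by
        have := hF.isLink t ht
        rcases Sym2.eq_iff.1 he with ⟨h1, h2⟩ | ⟨h1, h2⟩
        · rwa [h1, h2] at this
        · rw [h1, h2] at this
          exact this.symm
      obtain ⟨p, hp, hpl, hpI⟩ := hl
      refine ⟨p.map φ, hp.map hφ, by simpa using hpl, ?_⟩
      intro x hx
      rw [SimpleGraph.Walk.support_map, List.mem_map] at hx
      obtain ⟨z, hz, rfl⟩ := hx
      by_cases hza : z = a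
      · exact Or.inl (congrArg φ hza)
      by_cases hzb : z = b
      · exact Or.inr (Or.inl (congrArg φ hzb))
      exact Or.inr (Or.inr ⟨t, ht, he, z, (hpI z).2 ⟨hz, hza, hzb⟩, rfl⟩)
    · rintro a b c d - - hne x ⟨t, ht, he, z, hz, rfl⟩ ⟨t', ht', he', z', hz', hzz⟩
      obtain rfl := hφ hzz
      refine hF.disjoint t ht t' ht' ?_ _ hz hz'
      rintro rfl
      exact hne (Sym2.map.injective Subtype.val_injective (he.symm.trans he'))
    · rintro a b - c ⟨t, ht, -, z, hz, hzc⟩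
      refine hF.disjoint_ends t ht z hz ?_
      rw [hφ hzc]
      exact c.2
  have hcard : F.card ≤ H.graph.edgeSet.ncard := by
    have hfin : H.graph.edgeSet.Finite := Set.toFinite (α := Sym2 T) _
    rw [← Finset.card_image_of_injOn (f := fun t => s(t.1, t.2.1)) (s := F)
      (fun t ht t' ht' he => by
        by_contra hne
        exact hF.pair_ne t ht t' ht' hne he), ← Set.ncard_coe_finset]
    refine (Set.ncard_le_ncard ?_ (hfin.image (Sym2.map Subtype.val))).trans
      (Set.ncard_image_le hfin)
    intro e he
    obtain ⟨t, ht, rfl⟩ := Finset.mem_image.1 (Finset.mem_coe.1 he)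
    refine ⟨s(⟨t.1, hF.left_mem t ht⟩, ⟨t.2.1, hF.right_mem t ht⟩), ?_, rfl⟩
    exact ⟨fun h => hF.ne t ht (congrArg Subtype.val h), t, ht, rfl⟩
  have h1 : H.density ≤ c := (le_iSup₂ (f := fun H (_ : IsShallowTopMinor r H G) => H.density)
    H hH).trans hG
  have hT0 : (Nat.card H.V : ℝ≥0∞) ≠ 0 := by
    have : Nat.card H.V = T.card := Nat.card_eq_finsetCard T
    rw [this]
    exact_mod_cast hT.card_pos.ne'
  rw [density, ENNReal.div_le_iff hT0 (ENNReal.natCast_ne_top _)] at h1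
  have h2 : H.graph.edgeSet.ncard ≤ c * Nat.card H.V := by exact_mod_cast h1
  have h3 : Nat.card H.V = T.card := Nat.card_eq_finsetCard T
  rw [h3] at h2
  exact hcard.trans h2

theorem bounded_of_boundedExpansion {𝒢 : Set FinGraph.{u}} (h : BoundedExpansion 𝒢) :
    BoundedNbhdComplexity 𝒢 := by
  obtain ⟨f, hf⟩ := h
  have key : ∀ r, ∃ C : ℕ, classNbhdComplexity r 𝒢 ≤ C := by
    intro r
    -- Counting traces at radius `r` uses weak `2 * r`-reachability, hence separators at depth `2 *
    -- r` and links of length at most `2 * (2 * r) + 1`.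
    obtain ⟨c, hc⟩ := exists_nat_ge (f (2 * r))
    refine ⟨1 + (sepBound (2 * r) c + 1) ^ r *
      2 ^ ((sepBound (2 * r) c + 1) ^ (2 * r) * (r + 1)), ?_⟩
    refine iSup₂_le fun G hG => iSup_le fun H => iSup₂_le fun X hX => ?_
    have hGc : topGrad (2 * r) G ≤ c :=
      (le_iSup₂ (f := fun G (_ : G ∈ 𝒢) => topGrad (2 * r) G) G hG).trans
        ((hf _).trans (by exact_mod_cast hc))
    have := G.finite
    obtain ⟨g, hg, hsep⟩ := exists_order (linkSparse_of_topGrad_le hGc H.hom H.hom_injective)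
    refine ENNReal.div_le_of_le_mul ?_
    exact_mod_cast ncard_traces_le hg hsep X hX
  choose C hC using key
  exact ⟨fun r => C r, fun r => by simpa using hC r⟩

end Minors

/-! ### From bounded traces to bounded degeneracy. -/

section Degeneracy

variable {W : Type*}

/-- Disjoint vertex sets `X` and `Y` of `K` do not admit more than `ν * |X|` distinct choices of
neighbourhood traces on `X` of vertices of `Y` in subgraphs of `K`. -/
def TraceBounded (K : SimpleGraph W) (ν : ℕ) : Prop :=
  -- Isolated vertices are excluded because disjointness of paths does not keep an isolated branch
  -- vertex off the paths of a model.
  ∀ X Y : Finset W, X.Nonempty → (∀ x ∈ X, x ∉ Y) → (∀ x ∈ X, ∃ b, K.Adj x b) →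
    (∀ y ∈ Y, ∃ b, K.Adj y b) → ∀ π : W → Finset W, (∀ y ∈ Y, ∀ a ∈ π y, a ∈ X ∧ K.Adj y a) →
    Set.InjOn π Y → Y.card ≤ ν * X.card

lemma mul_lt_two_pow {ν k : ℕ} (h : 2 * ν + 1 ≤ k) : ν * k < 2 ^ k := by
  have key : ∀ k : ℕ, k * k < 2 * 2 ^ k := by
    intro k
    induction k with
    | zero => simp
    | succ k ih =>
      rcases lt_or_ge k 3 with hk | hk
      · interval_cases k <;> norm_num
      · rw [pow_succ]
        nlinarith
  have := key k
  nlinarith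

open Classical in
/-- Vertices with many neighbours in `X` can be given distinct subsets of their neighbourhoods. -/
lemma TraceBounded.card_le {K : SimpleGraph W} {ν : ℕ} (hK : TraceBounded K ν) {X Y : Finset W}
    (hX : X.Nonempty) (hXY : ∀ x ∈ X, x ∉ Y) (hXn : ∀ x ∈ X, ∃ b, K.Adj x b)
    (hY : ∀ y ∈ Y, 2 * ν + 1 ≤ (X.filter (K.Adj y)).card) : Y.card ≤ ν * X.card := by
  have hne : ∀ y ∈ Y, (X.filter (K.Adj y)).Nonempty := fun y hy =>
    Finset.card_pos.1 (by have := hY y hy; omega)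
  have hYn : ∀ y ∈ Y, ∃ b, K.Adj y b := fun y hy => by
    obtain ⟨b, hb⟩ := hne y hy
    exact ⟨b, (Finset.mem_filter.1 hb).2⟩
  obtain ⟨Y', hY', hmax⟩ := Finset.exists_max_image
    (Y.powerset.filter fun Y' : Finset W => ∃ π : W → Finset W, (∀ y ∈ Y', ∀ a ∈ π y, a ∈ X ∧ K.Adj y a) ∧
      Set.InjOn π Y') Finset.card ⟨∅, by simp⟩
  simp only [Finset.mem_filter, Finset.mem_powerset] at hY' hmax
  obtain ⟨hY'Y, π, hπ, hinj⟩ := hY'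
  by_cases hall : Y ⊆ Y'
  · exact hK X Y hX hXY hXn hYn π (fun y hy => hπ y (hall hy))
      (hinj.mono (Finset.coe_subset.2 hall))
  exfalso
  obtain ⟨b, hbY, hb⟩ := Finset.not_subset.1 hall
  set N := X.filter (K.Adj b) with hN
  have hNX : N ⊆ X := Finset.filter_subset _ _
  -- Were a subset of `N` unused, it could be assigned to `b`, enlarging `Y'`. So all `2 ^ |N|`
  -- subsets occur, more than the `ν * |N|` that the trace bound allows on `N`.
  have hsub : N.powerset ⊆ (Y'.filter fun y => π y ⊆ N).image π := by
    intro P hP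
    rw [Finset.mem_powerset] at hP
    by_contra hcon
    have hcon' : ∀ y ∈ Y', π y ≠ P := by
      rintro y hy rfl
      exact hcon (Finset.mem_image_of_mem _ (Finset.mem_filter.2 ⟨hy, hP⟩))
    have hupd : ∀ y ∈ Y', Function.update π b P y = π y := fun y hy =>
      Function.update_of_ne (by rintro rfl; exact hb hy) _ _
    have := hmax (insert b Y') ⟨Finset.insert_subset hbY hY'Y, Function.update π b P, ?_, ?_⟩
    · rw [Finset.card_insert_of_notMem hb] at this
      omega
    · intro y hy a ha
      rcases Finset.mem_insert.1 hy with rfl | hy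
      · rw [Function.update_self] at ha
        exact Finset.mem_filter.1 (hP ha)
      · rw [hupd y hy] at ha
        exact hπ y hy a ha
    · rw [Finset.coe_insert, Set.injOn_insert (by simpa using hb)]
      refine ⟨fun x hx y hy hxy => hinj hx hy ?_, ?_⟩
      · rwa [hupd x hx, hupd y hy] at hxy
      · rintro ⟨y, hy, hyb⟩
        rw [hupd y hy, Function.update_self] at hyb
        exact hcon' y hy hyb
  have h1 := hK N (Y'.filter fun y => π y ⊆ N) (hne b hbY)
    (fun x hx hx' => hXY x (hNX hx) (hY'Y (Finset.mem_filter.1 hx').1))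
    (fun x hx => hXn x (hNX hx)) (fun y hy => hYn y (hY'Y (Finset.mem_filter.1 hy).1)) π
    (fun y hy a ha => ⟨(Finset.mem_filter.1 hy).2 ha, (hπ y (Finset.mem_filter.1 hy).1 a ha).2⟩)
    (hinj.mono (Finset.coe_subset.2 (Finset.filter_subset _ _)))
  have h2 := (Finset.card_le_card hsub).trans Finset.card_image_le
  rw [Finset.card_powerset] at h2
  have h3 : ν * N.card < 2 ^ N.card := mul_lt_two_pow (hY b hbY)
  omega

/-- The degeneracy bound for trace-bounded graphs. -/
def degenBound (ν : ℕ) : ℕ := (2 * ν + 1) + 2 * (2 * (ν + 1) * (2 * ν + 1))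

-- If all degrees in `S` were large, a set `X` maximising `Φ X - l * |X|` would be small. Vertices
-- with at least `κ` neighbours in `X` number at most `ν * |X|` outside `X`, and double counting
-- shows that the unsaturated ones are fewer than half of `S`. Together these cannot fill `S`.
open Classical in
theorem TraceBounded.exists_low_degree {K : SimpleGraph W} {ν : ℕ} (hK : TraceBounded K ν)
    {S : Finset W} (hS : S.Nonempty) : ∃ v ∈ S, (S.filter (K.Adj v)).card ≤ degenBound ν := by
  by_contra! hcon
  set κ := 2 * ν + 1 with hκ
  set l := 2 * (ν + 1) * κ with hl
  have hD : degenBound ν = κ + 2 * l := rfl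
  have hSn : ∀ x ∈ S, ∃ b, K.Adj x b := fun x hx => by
    obtain ⟨b, hb⟩ := Finset.card_pos.1 ((Nat.zero_le _).trans_lt (hcon x hx))
    exact ⟨b, (Finset.mem_filter.1 hb).2⟩
  let Φ : Finset W → ℕ := fun X => ∑ b ∈ S, min κ (X.filter (K.Adj b)).card
  obtain ⟨X, hXS, hmax⟩ := Finset.exists_max_image S.powerset
    (fun X => (Φ X : ℤ) - l * X.card) ⟨∅, by simp⟩
  rw [Finset.mem_powerset] at hXS
  have hX1 : l * X.card ≤ Φ X := by
    have := hmax ∅ (by simp)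
    have h0 : Φ ∅ = 0 := by simp [Φ]
    rw [h0] at this
    simp only [Nat.cast_zero, Finset.card_empty, mul_zero, sub_zero] at this
    zify
    linarith
  have hX2 : Φ X ≤ S.card * κ := by
    rw [← smul_eq_mul]
    exact Finset.sum_le_card_nsmul _ _ _ fun _ _ => min_le_left _ _
  have hX3 : 2 * (ν + 1) * X.card ≤ S.card := by
    have : κ * (2 * (ν + 1) * X.card) ≤ κ * S.card := by
      calc _ = l * X.card := by rw [hl]; ring
        _ ≤ _ := hX1.trans (hX2.trans (mul_comm _ _).le)
    exact Nat.le_of_mul_le_mul_left this (by omega)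
  let U := S.filter fun b => (X.filter (K.Adj b)).card < κ
  have hU1 : ∀ a ∈ S \ X, (U.filter fun b => K.Adj b a).card ≤ l := by
    intro a ha
    rw [Finset.mem_sdiff] at ha
    have h1 := hmax (insert a X) (Finset.mem_powerset.2 (Finset.insert_subset ha.1 hXS))
    rw [Finset.card_insert_of_notMem ha.2] at h1
    -- Each unsaturated neighbour of `a` gains one in its truncated count when `a` joins `X`;
    -- maximality caps the total gain at `l`.
    have h2 : Φ X + (U.filter fun b => K.Adj b a).card ≤ Φ (insert a X) := by
      have : (U.filter fun b => K.Adj b a).card = ∑ b ∈ S,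
          if (X.filter (K.Adj b)).card < κ ∧ K.Adj b a then 1 else 0 := by
        rw [Finset.filter_filter, Finset.card_filter]
      rw [this, ← Finset.sum_add_distrib]
      refine Finset.sum_le_sum fun b _ => ?_
      split_ifs with hb
      · rw [Finset.filter_insert, if_pos hb.2, Finset.card_insert_of_notMem
          (fun h => ha.2 (Finset.mem_filter.1 h).1)]
        omega
      · have := Finset.card_le_card (Finset.filter_subset_filter (K.Adj b) (Finset.subset_insert a X))
        omega
    push_cast at h1
    zify at h2 ⊢
    linarith
  have hU2 : U.card * (2 * l + 1) ≤ l * S.card := by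
    calc U.card * (2 * l + 1) ≤ ∑ b ∈ U, ((S \ X).filter (K.Adj b)).card := by
          rw [← smul_eq_mul]
          refine Finset.card_nsmul_le_sum _ _ _ fun b hb => ?_
          obtain ⟨hbS, hb⟩ := Finset.mem_filter.1 hb
          have h1 := hcon b hbS
          have h2 : (S.filter (K.Adj b)).card ≤
              ((S \ X).filter (K.Adj b)).card + (X.filter (K.Adj b)).card := by
            refine (Finset.card_le_card fun x hx => ?_).trans (Finset.card_union_le _ _)
            simp only [Finset.mem_union, Finset.mem_filter, Finset.mem_sdiff] at hx ⊢
            tauto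
          omega
      _ = ∑ a ∈ S \ X, (U.filter fun b => K.Adj b a).card :=
          Finset.sum_card_bipartiteAbove_eq_sum_card_bipartiteBelow _
      _ ≤ (S \ X).card * l := by
          rw [← smul_eq_mul]
          exact Finset.sum_le_card_nsmul _ _ _ hU1
      _ ≤ l * S.card := by
          rw [mul_comm]
          exact Nat.mul_le_mul_left _ (Finset.card_le_card Finset.sdiff_subset)
  let Y := (S \ X) \ U
  have hY : ∀ y ∈ Y, κ ≤ (X.filter (K.Adj y)).card := by
    intro y hy
    simp only [Y, U, Finset.mem_sdiff, Finset.mem_filter, not_and, not_lt] at hy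
    exact hy.2 hy.1.1
  have hYX : Y.card ≤ ν * X.card := by
    rcases X.eq_empty_or_nonempty with rfl | hX
    · have : Y = ∅ := Finset.eq_empty_of_forall_notMem fun y hy => by
        have := hY y hy
        simp at this
      simp [this]
    · refine hK.card_le hX (fun x hx hxY => ?_) (fun x hx => hSn x (hXS hx)) hY
      simp only [Y, Finset.mem_sdiff] at hxY
      exact hxY.1.2 hx
  have hS1 : S.card ≤ X.card + (U.card + Y.card) := by
    refine (Finset.card_le_card (t := X ∪ (U ∪ Y)) fun x hx => ?_).trans
      ((Finset.card_union_le _ _).trans (Nat.add_le_add_left (Finset.card_union_le _ _) _))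
    simp only [Y, Finset.mem_union, Finset.mem_sdiff]
    tauto
  have hS0 := hS.card_pos
  have hl0 : 0 < l := by positivity
  -- `X` and `Y` together have at most `(ν + 1) * |X| ≤ |S| / 2` vertices.
  have h2 : S.card ≤ 2 * U.card := by nlinarith
  nlinarith

-- Deleting low-degree vertices one at a time loses at most `D` edges per vertex.
open Classical in
theorem ncard_edgeSet_le_of_degenerate [Fintype W] {K : SimpleGraph W} {D : ℕ}
    (h : ∀ S : Finset W, S.Nonempty → ∃ v ∈ S, (S.filter (K.Adj v)).card ≤ D) :
    K.edgeSet.ncard ≤ D * Nat.card W := by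
  suffices H : ∀ n, ∀ S : Finset W, S.card = n →
      (K.edgeFinset.filter fun e => ∀ x ∈ e, x ∈ S).card ≤ D * n by
    have := H _ Finset.univ rfl
    rw [Finset.filter_true_of_mem (by simp)] at this
    rwa [Set.ncard_eq_toFinset_card', Nat.card_eq_fintype_card]
  intro n
  induction n with
  | zero =>
    intro S hS
    rw [Finset.card_eq_zero] at hS
    subst hS
    rw [Finset.filter_false_of_mem]
    · simp
    · rintro ⟨a, b⟩ - hx
      simpa using hx a (Sym2.mem_mk_left a b)
  | succ n ih =>
    intro S hS
    obtain ⟨v, hv, hd⟩ := h S (Finset.card_pos.1 (by omega))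
    have h1 := ih (S.erase v) (by rw [Finset.card_erase_of_mem hv]; omega)
    have h2 : (K.edgeFinset.filter fun e => ∀ x ∈ e, x ∈ S) ⊆
        (K.edgeFinset.filter fun e => ∀ x ∈ e, x ∈ S.erase v) ∪
          (S.filter (K.Adj v)).image fun w => s(v, w) := by
      intro e he
      simp only [Finset.mem_union, Finset.mem_filter, Finset.mem_image, Finset.mem_erase,
        SimpleGraph.mem_edgeFinset] at he ⊢
      by_cases hve : v ∈ e
      · right
        obtain ⟨w, rfl⟩ := Sym2.mem_iff_exists.1 hve
        exact ⟨w, ⟨he.2 w (Sym2.mem_mk_right v w), he.1⟩, rfl⟩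
      · exact Or.inl ⟨he.1, fun x hx => ⟨by rintro rfl; exact hve hx, he.2 x hx⟩⟩
    have h3 := (Finset.card_le_card h2).trans (Finset.card_union_le _ _)
    have h4 := (Finset.card_image_le (s := S.filter (K.Adj v)) (f := fun w => s(v, w)))
    rw [mul_add]
    omega

end Degeneracy

/-! ### Traces realised by subgraphs of a topological minor model. -/

section Subdivisions

lemma getVert_of_mem_edges {V : Type*} {G : SimpleGraph V} {a b u : V} {p : G.Walk a b}
    (hp : p.IsPath) {i : ℕ} (hi : i ≤ p.length) (h : s(u, p.getVert i) ∈ p.edges) :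
    ∃ j ≤ i + 1, u = p.getVert j := by
  obtain ⟨j, hj, he⟩ := p.mk_mem_edges_iff_exists.1 h
  rcases Sym2.eq_iff.1 he with ⟨h1, h2⟩ | ⟨h1, h2⟩
  · have := hp.getVert_injOn (by simp; omega) (by simpa using hi) h2
    exact ⟨j, by omega, h1.symm⟩
  · have := hp.getVert_injOn (by simp; omega) (by simpa using hi) h1
    exact ⟨j + 1, by omega, h2.symm⟩

variable {H G : FinGraph.{u}} (φ : TopMinorEmbedding H G)

namespace TopMinorEmbedding

/-- A non-isolated branch vertex lies on a path of the model only as an end. -/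
lemma eq_or_eq_of_mem_support {a b c d : H.V} (h : H.graph.Adj a b) (hc : H.graph.Adj c d)
    (hmem : φ.vert c ∈ (φ.path h).support) : c = a ∨ c = b := by
  by_cases he : s(a, b) = s(c, d)
  · rcases Sym2.eq_iff.1 he with ⟨h1, -⟩ | ⟨-, h1⟩
    exacts [Or.inl h1.symm, Or.inr h1.symm]
  · exact (φ.internally_disjoint h hc he _ hmem (SimpleGraph.Walk.start_mem_support _)).1.imp
      (fun h => φ.vert_injective h) (fun h => φ.vert_injective h)

/-- The edges of `H` whose path has length exactly `l`. -/
def lengthGraph (l : ℕ) : SimpleGraph H.V where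
  Adj a b := ∃ h : H.graph.Adj a b, (φ.path h).length = l
  symm := ⟨fun a b ⟨h, hl⟩ => ⟨h.symm, by rw [φ.path_symm h, SimpleGraph.Walk.length_reverse, hl]⟩⟩
  loopless := ⟨fun _ ⟨h, _⟩ => h.ne rfl⟩

/-- The union of the paths that join the vertices `y ∈ Y` to the elements of `π y`. -/
def pathUnion (Y : Finset H.V) (π : H.V → Finset H.V) : SimpleGraph G.V where
  Adj u v := ∃ y ∈ Y, ∃ a ∈ π y, ∃ h : H.graph.Adj y a, s(u, v) ∈ (φ.path h).edges
  symm := ⟨fun u v ⟨y, hy, a, ha, h, he⟩ => ⟨y, hy, a, ha, h, by rwa [Sym2.eq_swap]⟩⟩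
  loopless := ⟨fun u ⟨y, hy, a, ha, h, he⟩ =>
    (SimpleGraph.Walk.adj_of_mem_edges _ he).ne rfl⟩

lemma pathUnion_le (Y : Finset H.V) (π : H.V → Finset H.V) : φ.pathUnion Y π ≤ G.graph := by
  rintro u v ⟨y, hy, a, ha, h, he⟩
  exact SimpleGraph.Walk.adj_of_mem_edges _ he

variable {φ} {l : ℕ} {X Y : Finset H.V} {π : H.V → Finset H.V}

/-- Short walks of the union of paths to `y` stay on the paths at `y`. -/
lemma eq_getVert_of_walk (hXY : ∀ x ∈ X, x ∉ Y) (hYn : ∀ y ∈ Y, ∃ b, H.graph.Adj y b)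
    (hπ : ∀ y ∈ Y, ∀ a ∈ π y, a ∈ X ∧ (φ.lengthGraph l).Adj y a) {y : H.V} (hy : y ∈ Y)
    {x z : G.V} (p : (φ.pathUnion Y π).Walk x z) (hz : z = φ.vert y) (hp : p.length ≤ l) :
    x = φ.vert y ∨ ∃ a ∈ π y, ∃ h : H.graph.Adj y a, ∃ i ≤ p.length, x = (φ.path h).getVert i := by
  induction p with
  | nil => exact Or.inl hz
  | @cons x' x z hadj p ih =>
    rw [SimpleGraph.Walk.length_cons] at hp ⊢
    obtain ⟨y', hy', a', ha', h', he⟩ := hadj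
    -- A kept path through the non-isolated branch vertex `y` ends there. Its other possible end
    -- lies in `X`, so the path starts at `y`.
    have start : x = φ.vert y → ∃ a ∈ π y, ∃ h : H.graph.Adj y a, ∃ i ≤ p.length + 1,
        x' = (φ.path h).getVert i := by
      intro hx
      have hmem := SimpleGraph.Walk.snd_mem_support_of_mem_edges _ he
      rw [hx] at hmem
      obtain ⟨b, hb⟩ := hYn y hy
      have hyy : y = y' := (φ.eq_or_eq_of_mem_support h' hb hmem).resolve_right
        (fun h => hXY a' (hπ y' hy' a' ha').1 (h ▸ hy))
      subst hyy
      have hx0 : x = (φ.path h').getVert 0 := by rw [SimpleGraph.Walk.getVert_zero, hx]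
      obtain ⟨j, hj, hx'⟩ := getVert_of_mem_edges (φ.isPath h') (Nat.zero_le _)
        (u := x') (by rwa [hx0] at he)
      exact ⟨a', ha', h', j, by omega, hx'⟩
    right
    rcases ih hz (by omega) with hx | ⟨a, ha, h, i, hi, hx⟩
    · exact start hx
    · obtain ⟨-, h₁, hl⟩ := hπ y hy a ha
      -- Along the same path the index grows by at most one. A switch to another path can happen
      -- only at an end, and `i < l` rules out the end `a`, leaving `y`.
      by_cases hs : s(y', a') = s(y, a)
      · rcases Sym2.eq_iff.1 hs with ⟨rfl, rfl⟩ | ⟨rfl, -⟩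
        · obtain ⟨j, hj, hx'⟩ := getVert_of_mem_edges (φ.isPath h) (i := i) (by omega)
            (u := x') (by rw [← hx]; exact he)
          exact ⟨a', ha, h, j, by omega, hx'⟩
        · exact absurd hy' (hXY _ (hπ y hy _ ha).1)
      · have hends := (φ.internally_disjoint h' h hs x
          (SimpleGraph.Walk.snd_mem_support_of_mem_edges _ he)
          (by rw [hx]; exact SimpleGraph.Walk.getVert_mem_support _ _)).2
        rcases hends with hxy | hxa
        · exact start hxy
        · have := ((φ.isPath h).getVert_eq_end_iff (i := i) (by omega)).1 (hx.symm.trans hxa)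
          omega

/-- All kept paths have length exactly `l`, so a walk of length at most `l` ending at `y` has no
room to pass through a second path. -/
lemma exists_walk_iff (hXY : ∀ x ∈ X, x ∉ Y) (hXn : ∀ x ∈ X, ∃ b, H.graph.Adj x b)
    (hYn : ∀ y ∈ Y, ∃ b, H.graph.Adj y b)
    (hπ : ∀ y ∈ Y, ∀ a ∈ π y, a ∈ X ∧ (φ.lengthGraph l).Adj y a) {x y : H.V} (hx : x ∈ X)
    (hy : y ∈ Y) :
    (∃ p : (φ.pathUnion Y π).Walk (φ.vert x) (φ.vert y), p.length ≤ l) ↔ x ∈ π y := by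
  constructor
  · rintro ⟨p, hp⟩
    rcases eq_getVert_of_walk hXY hYn hπ hy p rfl hp with h | ⟨a, ha, h, i, -, hi⟩
    · exact absurd hy (φ.vert_injective h ▸ hXY x hx)
    · obtain ⟨b, hb⟩ := hXn x hx
      have hmem : φ.vert x ∈ (φ.path h).support := by
        rw [hi]
        exact SimpleGraph.Walk.getVert_mem_support _ _
      rcases φ.eq_or_eq_of_mem_support h hb hmem with rfl | rfl
      exacts [absurd hy (hXY x hx), ha]
  · intro hxy
    obtain ⟨-, h, hl⟩ := hπ y hy x hxy
    refine ⟨((φ.path h).transfer (φ.pathUnion Y π) fun e he => ?_).reverse, ?_⟩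
    · induction e using Sym2.ind with
      | _ u v => exact ⟨y, hy, x, hxy, h, he⟩
    · rw [SimpleGraph.Walk.length_reverse, SimpleGraph.Walk.length_transfer, hl]

end TopMinorEmbedding

/-- In the spanning subgraph formed by the chosen paths, the trace of the `l`-ball at `y` is the
image of `π y`. Injectivity of `π` on `Y` thus gives `|Y|` distinct traces. -/
theorem traceBounded_of_nbhdComplexity_le {l ν : ℕ} (hG : nbhdComplexity l G ≤ ν) :
    TraceBounded (φ.lengthGraph l) ν := by
  classical
  intro X Y hX hXY hXn hYn π hπ hinj
  have hXn' : ∀ x ∈ X, ∃ b, H.graph.Adj x b := fun x hx => (hXn x hx).imp fun b hb => hb.1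
  have hYn' : ∀ y ∈ Y, ∃ b, H.graph.Adj y b := fun x hx => (hYn x hx).imp fun b hb => hb.1
  set K := φ.pathUnion Y π
  let S : G.graph.Subgraph := SimpleGraph.toSubgraph K (φ.pathUnion_le Y π)
  have hS : ∀ v, v ∈ S.verts := fun v => trivial
  let out : S.coe →g K := ⟨Subtype.val, fun h => h⟩
  let inn : K →g S.coe := ⟨fun v => ⟨v, hS v⟩, fun h => h⟩
  let X' : Set S.verts := (fun a => ⟨φ.vert a, hS _⟩) '' (X : Set H.V)
  have hX' : X'.Nonempty := hX.to_set.image _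
  have hmem : ∀ y ∈ Y, ∀ x ∈ X, inn (φ.vert x) ∈ closedNbhd S.coe l (inn (φ.vert y)) ∩ X' ↔
      x ∈ π y := by
    intro y hy x hx
    rw [← TopMinorEmbedding.exists_walk_iff hXY hXn' hYn' hπ hx hy, Set.mem_inter_iff,
      mem_closedNbhd_iff]
    constructor
    · rintro ⟨⟨p, hp⟩, -⟩
      exact ⟨p.map out, by rwa [SimpleGraph.Walk.length_map]⟩
    · rintro ⟨p, hp⟩
      exact ⟨⟨p.map inn, by rwa [SimpleGraph.Walk.length_map]⟩, x, hx, rfl⟩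
  let tr : H.V → Set S.verts := fun y => closedNbhd S.coe l (inn (φ.vert y)) ∩ X'
  have htr : Set.InjOn tr Y := by
    intro y hy y' hy' he
    refine hinj hy hy' (Finset.ext fun x => ⟨fun hx => ?_, fun hx => ?_⟩)
    · have hxX := (hπ y hy x hx).1
      exact (hmem y' hy' x hxX).1 (he ▸ (hmem y hy x hxX).2 hx : _ ∈ tr y')
    · have hxX := (hπ y' hy' x hx).1
      exact (hmem y hy x hxX).1 (he ▸ (hmem y' hy' x hxX).2 hx : _ ∈ tr y)
  have := G.finite
  have hle : Y.card ≤ (Set.range fun v => closedNbhd S.coe l v ∩ X').ncard := by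
    rw [← Set.ncard_coe_finset, ← htr.ncard_image]
    refine Set.ncard_le_ncard ?_ (Set.toFinite _)
    rintro _ ⟨y, -, rfl⟩
    exact ⟨inn (φ.vert y), rfl⟩
  have hXc : X'.ncard ≤ X.card := by
    rw [← Set.ncard_coe_finset]
    exact Set.ncard_image_le X.finite_toSet
  have h1 : ((Set.range fun v => closedNbhd S.coe l v ∩ X').ncard : ℝ≥0∞) / (X'.ncard : ℝ≥0∞) ≤ ν :=
    (le_iSup_of_le S (le_iSup₂ (f := fun (X : Set S.verts) (_ : X.Nonempty) =>
      ((Set.range fun v => closedNbhd S.coe l v ∩ X).ncard : ℝ≥0∞) / (X.ncard : ℝ≥0∞))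
      X' hX')).trans hG
  have hX0 : (X'.ncard : ℝ≥0∞) ≠ 0 := by
    exact_mod_cast ((Set.ncard_pos (Set.toFinite X')).2 hX').ne'
  rw [ENNReal.div_le_iff hX0 (ENNReal.natCast_ne_top _)] at h1
  have h2 : (Set.range fun v => closedNbhd S.coe l v ∩ X').ncard ≤ ν * X'.ncard := by
    exact_mod_cast h1
  exact hle.trans (h2.trans (Nat.mul_le_mul_left _ hXc))

theorem boundedExpansion_of_bounded {𝒢 : Set FinGraph.{u}} (h : BoundedNbhdComplexity 𝒢) :
    BoundedExpansion 𝒢 := by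
  classical
  obtain ⟨f, hf⟩ := h
  choose ν hν using fun l => exists_nat_ge (f l)
  -- Every edge of `H` lies in the length graph of some `l ≤ 2 * r + 1`, and each of these graphs is
  -- degenerate with its own constant.
  refine ⟨fun r => ((∑ l ∈ Finset.range (2 * r + 2), degenBound (ν l) : ℕ) : ℝ≥0), fun r => ?_⟩
  refine iSup₂_le fun G hG => iSup₂_le fun H hH => ?_
  obtain ⟨φ, hφ⟩ := hH
  have := H.finite
  have := Fintype.ofFinite H.V
  have hcount : ∀ l, (φ.lengthGraph l).edgeSet.ncard ≤ degenBound (ν l) * Nat.card H.V := by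
    intro l
    have hl : nbhdComplexity l G ≤ ν l :=
      (le_iSup₂ (f := fun G (_ : G ∈ 𝒢) => nbhdComplexity l G) G hG).trans
        ((hf l).trans (by exact_mod_cast hν l))
    exact ncard_edgeSet_le_of_degenerate fun S hS =>
      (traceBounded_of_nbhdComplexity_le φ hl).exists_low_degree hS
  have hsub : H.graph.edgeFinset ⊆
      (Finset.range (2 * r + 2)).biUnion fun l => (φ.lengthGraph l).edgeFinset := by
    intro e he
    induction e using Sym2.ind with
    | _ a b =>
      have hab : H.graph.Adj a b := by simpa using he
      have := hφ a b hab
      simp only [Finset.mem_biUnion, Finset.mem_range, SimpleGraph.mem_edgeFinset,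
        SimpleGraph.mem_edgeSet]
      exact ⟨(φ.path hab).length, by omega, hab, rfl⟩
  have hE : H.graph.edgeSet.ncard ≤
      (∑ l ∈ Finset.range (2 * r + 2), degenBound (ν l)) * Nat.card H.V := by
    rw [Set.ncard_eq_toFinset_card', Finset.sum_mul]
    refine (Finset.card_le_card hsub).trans (Finset.card_biUnion_le.trans
      (Finset.sum_le_sum fun l _ => ?_))
    have := hcount l
    rwa [Set.ncard_eq_toFinset_card'] at this
  refine ENNReal.div_le_of_le_mul ?_
  have : (H.graph.edgeSet.ncard : ℝ≥0∞) ≤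
    ((∑ l ∈ Finset.range (2 * r + 2), degenBound (ν l) : ℕ) : ℝ≥0∞) * (Nat.card H.V : ℝ≥0∞) := by
    exact_mod_cast hE
  simpa using this

end Subdivisions

end FinGraph

/-- A class of finite graphs has bounded expansion if and only if it has bounded neighbourhood
complexity. -/
theorem theorem1 (𝒢 : Set FinGraph.{u}) :
    FinGraph.BoundedExpansion 𝒢 ↔ FinGraph.BoundedNbhdComplexity 𝒢 :=
  ⟨FinGraph.bounded_of_boundedExpansion, FinGraph.boundedExpansion_of_bounded⟩
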